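/- Let $n\ge 1$. For a locally integrable function $f$ on $\mathbb R^n$ let $M_{\mathrm S}f(x)=\sup_{R\ni x}\frac1{|R|}\int_R|f|$ be the strong maximal function, where the supremum is over all bounded, nonempty, open rectangular parallelepipeds $R\subset\mathbb R^n$ containing $x$ whose sides are parallel to the coordinate axes. For $\alpha\in(0,1)$ let \[ C_{\mathrm S}(\alpha)=\sup_{E}\frac{1}{|E|}\bigl|\{x\in\mathbb R^n: M_{\mathrm S}\chi_E(x)>\alpha\}\bigr| \] be the associated sharp Tauberian constant, where the supremum is over all measurable $E\subset\mathbb R^n$ with $0<|E|<\infty$. Then $C_{\mathrm S}(\alpha)<\infty$ for every $\alpha\in(0,1)$, and $C_{\mathrm S}\in C^{1/n}(0,1)$, that is, $C_{\mathrm S}$ is locally H\"older continuous with exponent $1/n$ on $(0,1)$: for every compact $K\subset(0,1)$ there is a constant $C\ge 0$ (depending on $n$ and $K$) such that \[ |C_{\mathrm S}(x)-C_{\mathrm S}(y)|\le C\,|x-y|^{1/n}\qquad\text{for all }x,y\in K . \] -/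

import Mathlib

open MeasureTheory Set
open scoped NNReal ENNReal

noncomputable section

/-- The maximal operator `M_𝓑 f (x) = sup_{x ∈ R ∈ 𝓑} |R|⁻¹ ∫_R |f|` associated with a collection `𝓑`
of subsets of `ℝⁿ`. It takes values in `[0, ∞]`, so it is `0` at points which lie in no member of
`𝓑`. Here `Fin n → ℝ` carries the `n`-dimensional Lebesgue measure `volume`. -/
def maximalOperator {n : ℕ} (𝓑 : Set (Set (Fin n → ℝ))) (f : (Fin n → ℝ) → ℝ)
    (x : Fin n → ℝ) : ℝ≥0∞ :=
  ⨆ R ∈ 𝓑, ⨆ _ : x ∈ R, (∫⁻ y in R, ‖f y‖ₑ) / volume R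

/-- The halo set `{x : M_𝓑 χ_E (x) > α}`. -/
def haloSet {n : ℕ} (𝓑 : Set (Set (Fin n → ℝ))) (α : ℝ) (E : Set (Fin n → ℝ)) :
    Set (Fin n → ℝ) :=
  {x | ENNReal.ofReal α < maximalOperator 𝓑 (E.indicator fun _ => (1 : ℝ)) x}

/-- The sharp Tauberian constant `C_𝓑(α) = sup_E |{x : M_𝓑 χ_E (x) > α}| / |E|`, the supremum being
over the measurable sets `E` with `0 < |E| < ∞`, as an element of `[0, ∞]`. -/
def sharpTauberianConstant {n : ℕ} (𝓑 : Set (Set (Fin n → ℝ))) (α : ℝ) : ℝ≥0∞ :=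
  ⨆ (E : Set (Fin n → ℝ)) (_ : MeasurableSet E) (_ : 0 < volume E) (_ : volume E < ∞),
    volume (haloSet 𝓑 α E) / volume E

/-- The basis of the strong maximal operator: all (open, bounded, nonempty) rectangular
parallelepipeds in `ℝⁿ` whose sides are parallel to the coordinate axes. -/
def strongBasis (n : ℕ) : Set (Set (Fin n → ℝ)) :=
  {R | ∃ a b : Fin n → ℝ, (∀ i, a i < b i) ∧ R = univ.pi fun i => Ioo (a i) (b i)}

/-- The Hölder class `C^p(I)` of functions that are locally Hölder continuous with exponent `p`:
on every compact `K ⊆ I` one has `|f x - f y| ≤ C_K |x - y|^p`. -/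
def IsLocallyHolderOn (p : ℝ≥0) (f : ℝ → ℝ) (I : Set ℝ) : Prop :=
  ∀ K : Set ℝ, K ⊆ I → IsCompact K → ∃ C : ℝ≥0, HolderOnWith C p f K

/-!
The strong maximal operator has two properties that together give local Hölder continuity.

*Submultiplicativity*, `C(αβ) ≤ C(α) C(β)`. Let `H` be the halo of `E` at level `β`. If `E` has
density at most `β` in a box `R`, then `|E ∩ R| ≤ β |H ∩ R|`: otherwise `R` could be bisected one
coordinate at a time, with the intermediate value theorem adjusting the cut, into ever smaller boxes
with the same defect. By Lebesgue's density theorem `E` may be replaced by a compact subset of the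
open set `H`. The boxes shrink to a point, and whether it lies in `H` or not, they are eventually
contained in `H` or disjoint from the compact set, so have no defect. Hence a box in which `E` has
density more than `αβ` is one in which `H` has density more than `α`.

*Solyanik's estimate*, `(1 - 2η)ⁿ C(1 - ηⁿ) ≤ 1`. On the line, a finite family of intervals may be
thinned to one with overlap at most `2` and the same union, so intervals of which less than the
proportion `η` lies outside `U` have a union `W` with `|W| ≤ |U| + 2η |W|`. By Markov's inequality,
a rectangle `I × J` of defect less than `ηδ` has defect at least `η` only in a proportion less than
`δ` of its slices `I × {y}`, so the estimate tensorizes.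

Taking `η = (1 - x / y) ^ (1 / n)`, submultiplicativity gives `(1 - 2η)ⁿ C(x) ≤ C(y)`, and
Bernoulli's inequality turns this into `C(x) - C(y) ≤ 2nη C(x)` for `x < y`. Iterating
submultiplicativity from a level `1 - ηⁿ` with `η < 1 / 2` gives finiteness.
-/

open Filter Topology

section Interval

/-- If `k` at the midpoint does not lie between `k b` and `k a`, the intermediate value theorem
cuts off a piece longer than half of the interval at whose ends `k`, and hence `g`, agree. -/
theorem exists_half_subinterval_of_sub_lt_sub {k g : ℝ → ℝ} {a b : ℝ} (hab : a < b)
    (hk : ContinuousOn k (Icc a b))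
    (hkg : ∀ s t, a ≤ s → s < t → t ≤ b → k s = k t → g s = g t)
    (hle : k b ≤ k a) (hlt : g b - g a < k b - k a) :
    ∃ s t, a ≤ s ∧ s < t ∧ t ≤ b ∧ t - s ≤ (b - a) / 2 ∧ k t ≤ k s ∧ g t - g s < k t - k s := by
  obtain ⟨m, hm⟩ : ∃ m, m = (a + b) / 2 := ⟨_, rfl⟩
  have ham : a < m := by linarith
  have hmb : m < b := by linarith
  rcases lt_or_ge (k a) (k m) with ham_k | hma_k
  · obtain ⟨t, ht, hkt⟩ := intermediate_value_Icc' hmb.le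
      (hk.mono (Icc_subset_Icc_left ham.le)) ⟨hle, ham_k.le⟩
    have hgt : g a = g t := hkg a t le_rfl (ham.trans_le ht.1) ht.2 hkt.symm
    have htb : t ≠ b := by
      rintro rfl
      linarith
    exact ⟨t, b, ham.le.trans ht.1, lt_of_le_of_ne ht.2 htb, le_rfl, by linarith [ht.1],
      by linarith, by linarith⟩
  rcases lt_or_ge (k m) (k b) with hmb_k | hbm_k
  · obtain ⟨t, ht, hkt⟩ := intermediate_value_Icc' ham.le
      (hk.mono (Icc_subset_Icc_right hmb.le)) ⟨hmb_k.le, hle⟩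
    have hgt : g t = g b := hkg t b ht.1 (ht.2.trans_lt hmb) le_rfl hkt
    have hta : a ≠ t := by
      rintro rfl
      linarith
    exact ⟨a, t, le_rfl, lt_of_le_of_ne ht.1 hta, ht.2.trans hmb.le, by linarith [ht.2],
      by linarith, by linarith⟩
  rcases lt_or_ge (g m - g a) (k m - k a) with hleft | hright
  · exact ⟨a, m, le_rfl, ham, hmb.le, by linarith, hma_k, hleft⟩
  · exact ⟨m, b, ham.le, hmb, le_rfl, by linarith, hbm_k, by linarith⟩

variable (κ : Measure ℝ) [IsFiniteMeasure κ] [NullSingletonClass κ]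

theorem continuous_measureReal_Iic : Continuous fun t => κ.real (Iic t) := by
  have hprimitive (t : ℝ) : κ.real (Iic t) = κ.real (Iic 0) + ∫ _ in (0 : ℝ)..t, (1 : ℝ) ∂κ := by
    rw [← intervalIntegral.integral_Iic_sub_Iic (integrable_const 1).integrableOn
      (integrable_const 1).integrableOn]
    simp
  rw [funext hprimitive]
  exact continuous_const.add
    (intervalIntegral.continuous_primitive (fun _ _ => intervalIntegrable_const) 0)

theorem measureReal_Ioo_eq_sub {s t : ℝ} (hst : s ≤ t) :
    κ.real (Ioo s t) = κ.real (Iic t) - κ.real (Iic s) := by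
  rw [measureReal_congr Ioo_ae_eq_Ioc, ← Iic_sdiff_Iic,
    measureReal_sdiff (Iic_subset_Iic.2 hst) measurableSet_Iic]

variable {κ} {ν θ : Measure ℝ} [IsFiniteMeasure ν] [NullSingletonClass ν] [IsFiniteMeasure θ]
  [NullSingletonClass θ]

theorem exists_half_Ioo_measureReal {c a b : ℝ} (hab : a < b)
    (hexact : ∀ s t, a ≤ s → s < t → t ≤ b →
      κ.real (Ioo s t) = c * ν.real (Ioo s t) → θ.real (Ioo s t) = ν.real (Ioo s t))
    (hle : κ.real (Ioo a b) ≤ c * ν.real (Ioo a b))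
    (hlt : c * θ.real (Ioo a b) < κ.real (Ioo a b)) :
    ∃ s t, a ≤ s ∧ s < t ∧ t ≤ b ∧ t - s ≤ (b - a) / 2 ∧
      κ.real (Ioo s t) ≤ c * ν.real (Ioo s t) ∧ c * θ.real (Ioo s t) < κ.real (Ioo s t) := by
  simp only [measureReal_Ioo_eq_sub _ hab.le] at hle hlt
  obtain ⟨s, t, has, hst, htb, hhalf, hle', hlt'⟩ := exists_half_subinterval_of_sub_lt_sub
    (k := fun t => κ.real (Iic t) - c * ν.real (Iic t))
    (g := fun t => c * θ.real (Iic t) - c * ν.real (Iic t)) hab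
    ((continuous_measureReal_Iic κ).sub ((continuous_measureReal_Iic ν).const_mul c)).continuousOn
    (fun s t has hst htb hst_k => by
      have heq := hexact s t has hst htb (by
        simp only [measureReal_Ioo_eq_sub _ hst.le]
        linear_combination -hst_k)
      simp only [measureReal_Ioo_eq_sub _ hst.le] at heq
      linear_combination -c * heq)
    (by linarith) (by linarith)
  refine ⟨s, t, has, hst, htb, hhalf, ?_⟩
  simp only [measureReal_Ioo_eq_sub _ hst.le]
  constructor <;> linarith

end Interval

section OpenBox

variable {ι : Type*}

/-- The open box `∏ᵢ (aᵢ, bᵢ)`, which is empty unless `aᵢ < bᵢ` for all `i`. -/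
def openBox (a b : ι → ℝ) : Set (ι → ℝ) :=
  univ.pi fun i => Ioo (a i) (b i)

theorem mem_openBox {a b x : ι → ℝ} : x ∈ openBox a b ↔ ∀ i, x i ∈ Ioo (a i) (b i) :=
  mem_univ_pi

theorem openBox_subset_Icc (a b : ι → ℝ) : openBox a b ⊆ Icc a b := fun _ hx =>
  ⟨fun i => (mem_openBox.1 hx i).1.le, fun i => (mem_openBox.1 hx i).2.le⟩

theorem openBox_nonempty {a b : ι → ℝ} (hab : ∀ i, a i < b i) : (openBox a b).Nonempty :=
  univ_pi_nonempty_iff.2 fun i => nonempty_Ioo.2 (hab i)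

theorem openBox_update_update [DecidableEq ι] {a b : ι → ℝ} {i : ι} {s t : ℝ} (has : a i ≤ s)
    (htb : t ≤ b i) :
    openBox (Function.update a i s) (Function.update b i t) =
      {x | x i ∈ Ioo s t} ∩ openBox a b := by
  ext x
  simp only [mem_openBox, mem_inter_iff, mem_ofPred_eq]
  constructor
  · intro hx
    have hxi : x i ∈ Ioo s t := by simpa using hx i
    refine ⟨hxi, fun j => ?_⟩
    rcases eq_or_ne j i with rfl | hj
    · exact Ioo_subset_Ioo has htb hxi
    · simpa [hj] using hx j
  · rintro ⟨hxi, hx⟩ j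
    rcases eq_or_ne j i with rfl | hj
    · simpa using hxi
    · simpa [hj] using hx j

theorem isOpen_openBox [Finite ι] (a b : ι → ℝ) : IsOpen (openBox a b) :=
  isOpen_set_pi finite_univ fun _ _ => isOpen_Ioo

theorem measure_openBox_ne_top (μ : Measure (ι → ℝ)) [IsLocallyFiniteMeasure μ] (a b : ι → ℝ) :
    μ (openBox a b) ≠ ∞ :=
  measure_ne_top_of_subset (openBox_subset_Icc a b) isCompact_Icc.measure_lt_top.ne

theorem measure_openBox_ne_zero [Finite ι] (μ : Measure (ι → ℝ)) [μ.IsOpenPosMeasure] {a b : ι → ℝ}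
    (hab : ∀ i, a i < b i) : μ (openBox a b) ≠ 0 :=
  (isOpen_openBox a b).measure_ne_zero μ (openBox_nonempty hab)

theorem measure_inter_openBox_ne_top (μ : Measure (ι → ℝ)) [IsLocallyFiniteMeasure μ]
    (S : Set (ι → ℝ)) (a b : ι → ℝ) : μ (S ∩ openBox a b) ≠ ∞ :=
  measure_ne_top_of_subset inter_subset_right (measure_openBox_ne_top μ a b)

theorem openBox_subset_ball [Fintype ι] {a b x : ι → ℝ} {ε : ℝ} (hx : x ∈ Icc a b) (hε : 0 < ε)
    (hab : ∀ i, b i - a i < ε) : openBox a b ⊆ Metric.ball x ε := fun y hy =>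
  (dist_pi_lt_iff hε).2 fun i => by
    have hyi := mem_openBox.1 hy i
    rw [Real.dist_eq, abs_lt]
    constructor <;> linarith [hyi.1, hyi.2, hx.1 i, hx.2 i, hab i]

section Bisection

variable [Finite ι] [DecidableEq ι] {P : (ι → ℝ) → (ι → ℝ) → Prop}
  (halve : ∀ a b i, P a b → ∃ s t, a i ≤ s ∧ t ≤ b i ∧ t - s ≤ (b i - a i) / 2 ∧
    P (Function.update a i s) (Function.update b i t))
include halve

theorem exists_halved_box {a b : ι → ℝ} (hab : P a b) :
    ∃ a' b', P a' b' ∧ a ≤ a' ∧ b' ≤ b ∧ ∀ i, b' i - a' i ≤ (b i - a i) / 2 := by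
  suffices ∀ S : Finset ι, ∃ a' b', P a' b' ∧ a ≤ a' ∧ b' ≤ b ∧
      ∀ i ∈ S, b' i - a' i ≤ (b i - a i) / 2 by
    cases nonempty_fintype ι
    simpa using this Finset.univ
  intro S
  induction S using Finset.induction_on with
  | empty => exact ⟨a, b, hab, le_rfl, le_rfl, by simp⟩
  | insert i S _ ih =>
    obtain ⟨a', b', hP, ha, hb, hS⟩ := ih
    obtain ⟨s, t, hs, ht, hst, hP'⟩ := halve a' b' i hP
    have ha' : a' ≤ Function.update a' i s := le_update_self_iff.2 hs
    have hb' : Function.update b' i t ≤ b' := update_le_self_iff.2 ht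
    refine ⟨_, _, hP', ha.trans ha', hb'.trans hb, fun j hj => ?_⟩
    rcases eq_or_ne j i with rfl | hji
    · simp only [Function.update_self]
      linarith [ha j, hb j]
    · simpa [hji] using hS j (Finset.mem_of_mem_insert_of_ne hj hji)

theorem exists_box_sub_le_div_two_pow {a b : ι → ℝ} (hab : P a b) (k : ℕ) :
    ∃ a' b', P a' b' ∧ a ≤ a' ∧ b' ≤ b ∧ ∀ i, b' i - a' i ≤ (b i - a i) / 2 ^ k := by
  induction k with
  | zero => exact ⟨a, b, hab, le_rfl, le_rfl, by simp⟩
  | succ k ih =>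
    obtain ⟨a', b', hP, ha, hb, hk⟩ := ih
    obtain ⟨a'', b'', hP', ha', hb', hhalf⟩ := exists_halved_box halve hP
    refine ⟨a'', b'', hP', ha.trans ha', hb'.trans hb, fun i => (hhalf i).trans ?_⟩
    rw [pow_succ, ← div_div]
    linarith [hk i]

theorem exists_forall_mem_nhds_exists_openBox_subset (hle : ∀ a b, P a b → a ≤ b) {a b : ι → ℝ}
    (hab : P a b) : ∃ x, ∀ U ∈ 𝓝 x, ∃ a' b', P a' b' ∧ openBox a' b' ⊆ U := by
  by_contra! hcon
  choose U hU hPU using hcon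
  cases nonempty_fintype ι
  obtain ⟨ε, hε, hεU⟩ := lebesgue_number_lemma_of_metric (s := Icc a b) isCompact_Icc
    (c := fun x => interior (U x)) (fun _ => isOpen_interior)
    fun x _ => mem_iUnion.2 ⟨x, mem_interior_iff_mem_nhds.2 (hU x)⟩
  have hsmall : ∀ᶠ k : ℕ in atTop, ∀ i, (b i - a i) / 2 ^ k < ε :=
    Filter.eventually_all.2 fun _ => (tendsto_const_nhds.div_atTop
      (tendsto_pow_atTop_atTop_of_one_lt one_lt_two)).eventually_lt_const hε
  obtain ⟨k, hk⟩ := hsmall.exists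
  obtain ⟨a', b', hP, ha, hb, hab'⟩ := exists_box_sub_le_div_two_pow halve hab k
  obtain ⟨x, hx⟩ := hεU a' ⟨ha, (hle _ _ hP).trans hb⟩
  refine hPU x a' b' hP (subset_trans ?_ (hx.trans interior_subset))
  exact openBox_subset_ball ⟨le_rfl, hle _ _ hP⟩ hε fun i => (hab' i).trans_lt (hk i)

end Bisection

end OpenBox

section RisingSun

theorem measureReal_le_of_forall_isCompact {X : Type*} [TopologicalSpace X] [MeasurableSpace X]
    {μ : Measure X} [IsFiniteMeasureOnCompacts μ] [μ.InnerRegularCompactLTTop] {S : Set X}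
    (hS : MeasurableSet S)
    (hS_top : μ S ≠ ∞) {m : ℝ} (h : ∀ K ⊆ S, IsCompact K → μ.real K ≤ m) : μ.real S ≤ m := by
  have hm : 0 ≤ m := by simpa using h ∅ (empty_subset S) isCompact_empty
  refine ENNReal.toReal_le_of_le_ofReal hm ?_
  rw [hS.measure_eq_iSup_isCompact_of_ne_top hS_top]
  refine iSup₂_le fun K hKS => iSup_le fun hK => ?_
  exact ENNReal.le_ofReal_iff_toReal_le hK.measure_lt_top.ne hm |>.2 (h K hKS hK)

variable {ι : Type*} (μ : Measure (ι → ℝ))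

/-- The image of `μ` restricted to `S` under the `i`-th coordinate. On subintervals of a side of a
box it gives the measure of the part of `S` in the corresponding slab of the box. -/
def coordMarginal (S : Set (ι → ℝ)) (i : ι) : Measure ℝ :=
  (μ.restrict S).map fun x => x i

instance isFiniteMeasure_coordMarginal_inter_openBox [IsLocallyFiniteMeasure μ]
    (M : Set (ι → ℝ)) (a b : ι → ℝ) (i : ι) :
    IsFiniteMeasure (coordMarginal μ (M ∩ openBox a b) i) := by
  have : IsFiniteMeasure (μ.restrict (M ∩ openBox a b)) :=
    isFiniteMeasure_restrict.2 (measure_inter_openBox_ne_top μ M a b)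
  exact Measure.isFiniteMeasure_map _ _

variable {μ}

theorem nullSingletonClass_coordMarginal {i : ι} (hμ : ∀ t, μ {x | x i = t} = 0)
    (S : Set (ι → ℝ)) : NullSingletonClass (coordMarginal μ S i) where
  measure_singleton t := by
    rw [coordMarginal, Measure.map_apply (measurable_pi_apply i) (measurableSet_singleton t)]
    exact Measure.restrict_le_self.absolutelyContinuous (hμ t)

theorem coordMarginal_real_Ioo [DecidableEq ι] (M : Set (ι → ℝ)) {a b : ι → ℝ} {i : ι} {s t : ℝ}
    (has : a i ≤ s) (htb : t ≤ b i) :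
    (coordMarginal μ (M ∩ openBox a b) i).real (Ioo s t) =
      μ.real (M ∩ openBox (Function.update a i s) (Function.update b i t)) := by
  have hslab : MeasurableSet ((fun x : ι → ℝ => x i) ⁻¹' Ioo s t) :=
    measurable_pi_apply i measurableSet_Ioo
  rw [coordMarginal, map_measureReal_apply (measurable_pi_apply i) measurableSet_Ioo,
    measureReal_restrict_apply hslab, openBox_update_update has htb, inter_left_comm]
  rfl

variable (μ) in
/-- A box is defective for `K ⊆ H` at level `c` if `K` has density at most `c` in it, although `K`
fills more than the proportion `c` of the part of `H` in the box. -/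
structure IsDefective (K H : Set (ι → ℝ)) (c : ℝ) (a b : ι → ℝ) : Prop where
  le : μ.real (K ∩ openBox a b) ≤ c * μ.real (openBox a b)
  gt : c * μ.real (H ∩ openBox a b) < μ.real (K ∩ openBox a b)

theorem IsDefective.lt {K H : Set (ι → ℝ)} {c : ℝ} {a b : ι → ℝ} (h : IsDefective μ K H c a b)
    (i : ι) : a i < b i := by
  by_contra hi
  have hempty : openBox a b = ∅ := univ_pi_eq_empty (i := i) (Ioo_eq_empty hi)
  simpa [hempty] using h.gt

variable [IsLocallyFiniteMeasure μ]

theorem IsDefective.exists_half [DecidableEq ι] (hμ : ∀ i t, μ {x | x i = t} = 0)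
    {K H : Set (ι → ℝ)} {c : ℝ}
    (hexact : ∀ a b, μ.real (K ∩ openBox a b) = c * μ.real (openBox a b) →
      μ.real (H ∩ openBox a b) = μ.real (openBox a b))
    {a b : ι → ℝ} (h : IsDefective μ K H c a b) (i : ι) :
    ∃ s t, a i ≤ s ∧ t ≤ b i ∧ t - s ≤ (b i - a i) / 2 ∧
      IsDefective μ K H c (Function.update a i s) (Function.update b i t) := by
  have hnull (S) : NullSingletonClass (coordMarginal μ S i) :=
    nullSingletonClass_coordMarginal (hμ i) S
  have hK {s t} (has : a i ≤ s) (htb : t ≤ b i) := coordMarginal_real_Ioo (μ := μ) K has htb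
  have hH {s t} (has : a i ≤ s) (htb : t ≤ b i) := coordMarginal_real_Ioo (μ := μ) H has htb
  have hbox {s t} (has : a i ≤ s) (htb : t ≤ b i) := coordMarginal_real_Ioo (μ := μ) univ has htb
  simp only [univ_inter (openBox (Function.update _ _ _) _)] at hbox
  obtain ⟨s, t, has, -, htb, hhalf, hle, hgt⟩ := exists_half_Ioo_measureReal
    (κ := coordMarginal μ (K ∩ openBox a b) i) (ν := coordMarginal μ (univ ∩ openBox a b) i)
    (θ := coordMarginal μ (H ∩ openBox a b) i) (c := c) (h.lt i)
    (fun s t has _ htb => by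
      rw [hK has htb, hbox has htb, hH has htb]
      exact hexact _ _)
    (by simpa only [hK le_rfl le_rfl, hbox le_rfl le_rfl, Function.update_eq_self] using h.le)
    (by simpa only [hK le_rfl le_rfl, hH le_rfl le_rfl, Function.update_eq_self] using h.gt)
  rw [hK has htb] at hle hgt
  rw [hbox has htb] at hle
  rw [hH has htb] at hgt
  exact ⟨s, t, has, htb, hhalf, hle, hgt⟩

variable [Finite ι]

theorem not_isDefective (hμ : ∀ i t, μ {x | x i = t} = 0) {K H : Set (ι → ℝ)}
    (hK : IsClosed K) (hH : IsOpen H) (hKH : K ⊆ H) {c : ℝ} (hc : 0 ≤ c)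
    (hexact : ∀ a b, μ.real (K ∩ openBox a b) = c * μ.real (openBox a b) →
      μ.real (H ∩ openBox a b) = μ.real (openBox a b))
    (a b : ι → ℝ) : ¬ IsDefective μ K H c a b := by
  classical
  intro h
  obtain ⟨x, hx⟩ := exists_forall_mem_nhds_exists_openBox_subset
    (fun _ _ i h => h.exists_half hμ hexact i) (fun _ _ h i => (h.lt i).le) h
  by_cases hxH : x ∈ H
  · obtain ⟨a', b', h', hsub⟩ := hx H (hH.mem_nhds hxH)
    have hgt := h'.gt
    rw [inter_eq_right.2 hsub] at hgt
    exact hgt.not_ge h'.le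
  · obtain ⟨a', b', h', hsub⟩ := hx Kᶜ (hK.isOpen_compl.mem_nhds fun hxK => hxH (hKH hxK))
    have hgt := h'.gt
    rw [(subset_compl_iff_disjoint_left.1 hsub).inter_eq, measureReal_empty] at hgt
    exact hgt.not_ge (mul_nonneg hc measureReal_nonneg)

theorem measureReal_inter_openBox_le_mul_of_isCompact (hμ : ∀ i t, μ {x | x i = t} = 0)
    {K E H : Set (ι → ℝ)} (hK : IsCompact K) (hKE : K ⊆ E) (hKH : K ⊆ H) (hH : IsOpen H)
    {β c : ℝ} (hβ : 0 ≤ β) (hβc : β < c)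
    (hdense : ∀ a b, β * μ.real (openBox a b) < μ.real (E ∩ openBox a b) → openBox a b ⊆ H)
    {a b : ι → ℝ} (hle : μ.real (E ∩ openBox a b) ≤ β * μ.real (openBox a b)) :
    μ.real (K ∩ openBox a b) ≤ c * μ.real (H ∩ openBox a b) := by
  have hK_le (p q) : μ.real (K ∩ openBox p q) ≤ μ.real (E ∩ openBox p q) :=
    measureReal_mono (inter_subset_inter_left _ hKE) (measure_inter_openBox_ne_top μ _ _ _)
  -- A box in which `K` has density exactly `c` is one in which `E` has density above `β`.
  have hexact (p q) (heq : μ.real (K ∩ openBox p q) = c * μ.real (openBox p q)) :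
      μ.real (H ∩ openBox p q) = μ.real (openBox p q) := by
    rcases (measureReal_nonneg (μ := μ) (s := openBox p q)).eq_or_lt with hzero | hpos
    · exact le_antisymm (measureReal_mono inter_subset_right (measure_openBox_ne_top μ p q))
        (hzero ▸ measureReal_nonneg)
    · have hlt : β * μ.real (openBox p q) < μ.real (E ∩ openBox p q) :=
        (mul_lt_mul_of_pos_right hβc hpos).trans_le (heq ▸ hK_le p q)
      rw [inter_eq_right.2 (hdense p q hlt)]
  refine not_lt.1 fun hgt =>
    not_isDefective hμ hK.isClosed hH hKH (hβ.trans hβc.le) hexact a b ⟨?_, hgt⟩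
  exact (hK_le a b).trans (hle.trans (mul_le_mul_of_nonneg_right hβc.le measureReal_nonneg))

theorem measureReal_inter_openBox_le_mul (hμ : ∀ i t, μ {x | x i = t} = 0) {E H : Set (ι → ℝ)}
    (hE : MeasurableSet E) (hH : IsOpen H) (hEH : ∀ᵐ x ∂μ, x ∈ E → x ∈ H) {β : ℝ} (hβ : 0 ≤ β)
    (hdense : ∀ a b, β * μ.real (openBox a b) < μ.real (E ∩ openBox a b) → openBox a b ⊆ H)
    {a b : ι → ℝ} (hle : μ.real (E ∩ openBox a b) ≤ β * μ.real (openBox a b)) :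
    μ.real (E ∩ openBox a b) ≤ β * μ.real (H ∩ openBox a b) := by
  have hae : ((E ∩ H) ∩ openBox a b : Set (ι → ℝ)) =ᵐ[μ] (E ∩ openBox a b : Set (ι → ℝ)) := by
    filter_upwards [hEH] with x hx
    exact propext ⟨fun h => ⟨h.1.1, h.2⟩, fun h => ⟨⟨h.1, hx h.1⟩, h.2⟩⟩
  have hlevel (c : ℝ) (hc : c ∈ Ioi β) :
      μ.real (E ∩ openBox a b) ≤ c * μ.real (H ∩ openBox a b) := by
    rw [← measureReal_congr hae]
    refine measureReal_le_of_forall_isCompact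
      ((hE.inter hH.measurableSet).inter (isOpen_openBox a b).measurableSet)
      (measure_inter_openBox_ne_top μ _ a b) fun K hKE hK => ?_
    rw [← inter_eq_left.2 (hKE.trans inter_subset_right)]
    exact measureReal_inter_openBox_le_mul_of_isCompact hμ hK (fun x hx => (hKE hx).1.1)
      (fun x hx => (hKE hx).1.2) hH hβ hc hdense hle
  exact ge_of_tendsto (((continuous_mul_const _).tendsto β).mono_left nhdsWithin_le_nhds)
    (eventually_nhdsWithin_of_forall hlevel)

end RisingSun

section HaloSet

variable {n : ℕ}

theorem openBox_mem_strongBasis {a b : Fin n → ℝ} (hab : ∀ i, a i < b i) :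
    openBox a b ∈ strongBasis n :=
  ⟨a, b, hab, rfl⟩

theorem isOpen_of_mem_strongBasis {R : Set (Fin n → ℝ)} (hR : R ∈ strongBasis n) : IsOpen R := by
  obtain ⟨a, b, -, rfl⟩ := hR
  exact isOpen_openBox a b

theorem volume_ne_top_of_mem_strongBasis {R : Set (Fin n → ℝ)} (hR : R ∈ strongBasis n) :
    volume R ≠ ∞ := by
  obtain ⟨a, b, -, rfl⟩ := hR
  exact measure_openBox_ne_top volume a b

theorem volume_ne_zero_of_mem_strongBasis {R : Set (Fin n → ℝ)} (hR : R ∈ strongBasis n) :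
    volume R ≠ 0 := by
  obtain ⟨a, b, hab, rfl⟩ := hR
  exact measure_openBox_ne_zero volume hab

theorem setLIntegral_enorm_indicator_one {X : Type*} [MeasurableSpace X] (μ : Measure X)
    {E : Set X} (hE : MeasurableSet E) (R : Set X) :
    ∫⁻ y in R, ‖E.indicator (fun _ => (1 : ℝ)) y‖ₑ ∂μ = μ (E ∩ R) := by
  simp only [enorm_indicator_eq_indicator_enorm, enorm_one]
  rw [lintegral_indicator_const hE, one_mul, Measure.restrict_apply hE]

theorem haloSet_strongBasis_eq_sUnion (α : ℝ) {E : Set (Fin n → ℝ)} (hE : MeasurableSet E) :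
    haloSet (strongBasis n) α E =
      ⋃₀ {R ∈ strongBasis n | ENNReal.ofReal α * volume R < volume (E ∩ R)} := by
  ext x
  simp only [haloSet, maximalOperator, setLIntegral_enorm_indicator_one volume hE, lt_iSup_iff,
    mem_ofPred_eq, mem_sUnion, exists_prop, and_assoc]
  refine exists_congr fun R => and_congr_right fun hR => and_comm.trans (and_congr_left' ?_)
  exact ENNReal.lt_div_iff_mul_lt (.inl (volume_ne_zero_of_mem_strongBasis hR))
    (.inl (volume_ne_top_of_mem_strongBasis hR))

theorem isOpen_haloSet_strongBasis (α : ℝ) {E : Set (Fin n → ℝ)} (hE : MeasurableSet E) :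
    IsOpen (haloSet (strongBasis n) α E) := by
  rw [haloSet_strongBasis_eq_sUnion α hE]
  exact isOpen_sUnion fun R hR => isOpen_of_mem_strongBasis hR.1

theorem ofReal_mul_measure_lt_iff {X : Type*} [MeasurableSpace X] {μ : Measure X} {α : ℝ}
    (hα : 0 ≤ α) {R S : Set X} (hR : μ R ≠ ∞) (hS : μ S ≠ ∞) :
    ENNReal.ofReal α * μ R < μ S ↔ α * μ.real R < μ.real S := by
  rw [← ENNReal.toReal_lt_toReal (ENNReal.mul_ne_top ENNReal.ofReal_ne_top hR) hS,
    ENNReal.toReal_mul, ENNReal.toReal_ofReal hα]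
  rfl

theorem mem_haloSet_strongBasis {α : ℝ} (hα : 0 ≤ α) {E : Set (Fin n → ℝ)}
    (hE : MeasurableSet E) {x : Fin n → ℝ} :
    x ∈ haloSet (strongBasis n) α E ↔
      ∃ a b, x ∈ openBox a b ∧ α * volume.real (openBox a b) < volume.real (E ∩ openBox a b) := by
  have hlt (a b) := ofReal_mul_measure_lt_iff (μ := volume) hα (measure_openBox_ne_top volume a b)
    (measure_inter_openBox_ne_top volume E a b)
  rw [haloSet_strongBasis_eq_sUnion α hE]
  constructor
  · rintro ⟨_, ⟨⟨a, b, -, rfl⟩, hR⟩, hx⟩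
    exact ⟨a, b, hx, (hlt a b).1 hR⟩
  · rintro ⟨a, b, hx, hR⟩
    have hab (i) : a i < b i := (mem_openBox.1 hx i).1.trans (mem_openBox.1 hx i).2
    exact ⟨_, ⟨openBox_mem_strongBasis hab, (hlt a b).2 hR⟩, hx⟩

theorem openBox_subset_haloSet {α : ℝ} (hα : 0 ≤ α) {E : Set (Fin n → ℝ)} (hE : MeasurableSet E)
    {a b : Fin n → ℝ} (h : α * volume.real (openBox a b) < volume.real (E ∩ openBox a b)) :
    openBox a b ⊆ haloSet (strongBasis n) α E := fun _ hx =>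
  (mem_haloSet_strongBasis hα hE).2 ⟨a, b, hx, h⟩

theorem ae_mem_haloSet_strongBasis {α : ℝ} (hα : α < 1) {E : Set (Fin n → ℝ)}
    (hE : MeasurableSet E) : ∀ᵐ x, x ∈ E → x ∈ haloSet (strongBasis n) α E := by
  have hdensity := Besicovitch.ae_tendsto_measure_inter_div (volume : Measure (Fin n → ℝ)) E
  rw [ae_restrict_iff' hE] at hdensity
  filter_upwards [hdensity] with x hx hxE
  have hα' : ENNReal.ofReal α < 1 := by simpa using hα
  obtain ⟨r, hr, hr0 : 0 < r⟩ :=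
    (((hx hxE).eventually (lt_mem_nhds hα')).and self_mem_nhdsWithin).exists
  have hball : Metric.ball x r ∈ strongBasis n :=
    ⟨fun i => x i - r, fun i => x i + r, fun i => by linarith, by
      rw [ball_pi _ hr0]
      simp only [Real.ball_eq_Ioo]⟩
  have hae : Metric.closedBall x r =ᵐ[volume] Metric.ball x r := by
    rw [← Metric.ball_union_sphere]
    exact union_ae_eq_left_of_ae_eq_empty
      (ae_eq_empty.2 (Measure.addHaar_sphere_of_ne_zero volume x hr0.ne'))
  rw [measure_congr hae, measure_congr ((ae_eq_refl E).inter hae), ENNReal.lt_div_iff_mul_lt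
    (.inl (volume_ne_zero_of_mem_strongBasis hball))
    (.inl (volume_ne_top_of_mem_strongBasis hball))] at hr
  rw [haloSet_strongBasis_eq_sUnion α hE]
  exact ⟨_, ⟨hball, hr⟩, Metric.mem_ball_self hr0⟩

theorem volume_setOf_apply_eq (i : Fin n) (t : ℝ) : volume {x : Fin n → ℝ | x i = t} = 0 :=
  Measure.pi_hyperplane (α := fun _ => ℝ) (fun _ => volume) i t

/-- By the rising sun lemma a box outside the halo of level `β` loses at most the factor `β` when
`E` is replaced by its halo. -/
theorem haloSet_mul_subset {α β : ℝ} (hα : α ∈ Ico (0 : ℝ) 1) (hβ : β ∈ Ico (0 : ℝ) 1)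
    {E : Set (Fin n → ℝ)} (hE : MeasurableSet E) :
    haloSet (strongBasis n) (α * β) E ⊆
      haloSet (strongBasis n) α (haloSet (strongBasis n) β E) := by
  intro x hx
  have hopen := isOpen_haloSet_strongBasis β hE
  obtain ⟨a, b, hxR, hR⟩ := (mem_haloSet_strongBasis (mul_nonneg hα.1 hβ.1) hE).1 hx
  refine (mem_haloSet_strongBasis hα.1 hopen.measurableSet).2 ⟨a, b, hxR, ?_⟩
  rcases lt_or_ge (β * volume.real (openBox a b)) (volume.real (E ∩ openBox a b)) with hlt | hle
  · rw [inter_eq_right.2 (openBox_subset_haloSet hβ.1 hE hlt)]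
    have hpos : 0 < volume.real (openBox a b) :=
      ENNReal.toReal_pos ((isOpen_openBox a b).measure_ne_zero _ ⟨x, hxR⟩)
        (measure_openBox_ne_top _ a b)
    exact mul_lt_of_lt_one_left hpos hα.2
  · have hrise := measureReal_inter_openBox_le_mul volume_setOf_apply_eq hE hopen
      (ae_mem_haloSet_strongBasis hβ.2 hE) hβ.1
      (fun _ _ => openBox_subset_haloSet hβ.1 hE) hle
    refine lt_of_mul_lt_mul_left (hR.trans_le hrise |>.trans_eq' ?_) hβ.1
    ring

end HaloSet

section TauberianConstant

variable {n : ℕ}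

theorem haloSet_anti (𝓑 : Set (Set (Fin n → ℝ))) (E : Set (Fin n → ℝ)) :
    Antitone fun α => haloSet 𝓑 α E := fun _ _ hαβ _ hx =>
  (ENNReal.ofReal_le_ofReal hαβ).trans_lt hx

theorem sharpTauberianConstant_anti (𝓑 : Set (Set (Fin n → ℝ))) :
    Antitone (sharpTauberianConstant 𝓑) := fun _ _ hαβ =>
  iSup₂_mono fun E _ => iSup₂_mono fun _ _ =>
    ENNReal.div_le_div_right (measure_mono (haloSet_anti 𝓑 E hαβ)) _

theorem sharpTauberianConstant_le {𝓑 : Set (Set (Fin n → ℝ))} {α : ℝ} {C : ℝ≥0∞}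
    (h : ∀ E : Set (Fin n → ℝ), MeasurableSet E → volume E ≠ 0 → volume E ≠ ∞ →
      volume (haloSet 𝓑 α E) ≤ C * volume E) : sharpTauberianConstant 𝓑 α ≤ C :=
  iSup₂_le fun E hE => iSup₂_le fun hE_pos hE_top =>
    ENNReal.div_le_of_le_mul (h E hE hE_pos.ne' hE_top.ne)

theorem one_le_sharpTauberianConstant {α : ℝ} (hα : α < 1) :
    1 ≤ sharpTauberianConstant (strongBasis n) α := by
  have hcube : openBox 0 1 ∈ strongBasis n := openBox_mem_strongBasis fun _ => zero_lt_one
  have hpos := volume_ne_zero_of_mem_strongBasis hcube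
  have htop := volume_ne_top_of_mem_strongBasis hcube
  have hmeas := (isOpen_of_mem_strongBasis hcube).measurableSet
  calc 1 ≤ volume (haloSet (strongBasis n) α (openBox 0 1)) / volume (openBox 0 1) := by
        rw [ENNReal.le_div_iff_mul_le (.inl hpos) (.inl htop), one_mul]
        exact measure_mono_ae (ae_mem_haloSet_strongBasis hα hmeas)
    _ ≤ sharpTauberianConstant (strongBasis n) α :=
        le_iSup₂_of_le _ hmeas (le_iSup₂_of_le (pos_iff_ne_zero.2 hpos) htop.lt_top le_rfl)

theorem volume_haloSet_le {α : ℝ} (hα : α < 1) {E : Set (Fin n → ℝ)} (hE : MeasurableSet E) :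
    volume (haloSet (strongBasis n) α E) ≤
      sharpTauberianConstant (strongBasis n) α * volume E := by
  rcases eq_or_ne (volume E) 0 with hzero | hpos
  · have hempty : haloSet (strongBasis n) α E = ∅ := by
      rw [haloSet_strongBasis_eq_sUnion α hE, sUnion_eq_empty]
      rintro R ⟨-, hR⟩
      simp [measure_mono_null inter_subset_left hzero] at hR
    simp [hempty]
  rcases eq_or_ne (volume E) ∞ with htop | hfin
  · rw [htop, ENNReal.mul_top (one_pos.trans_le (one_le_sharpTauberianConstant hα)).ne']
    exact le_top
  · rw [← ENNReal.div_le_iff hpos hfin]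
    exact le_iSup₂_of_le E hE (le_iSup₂_of_le (pos_iff_ne_zero.2 hpos) hfin.lt_top le_rfl)

theorem sharpTauberianConstant_mul_le {α β : ℝ} (hα : α ∈ Ico (0 : ℝ) 1)
    (hβ : β ∈ Ico (0 : ℝ) 1) :
    sharpTauberianConstant (strongBasis n) (α * β) ≤
      sharpTauberianConstant (strongBasis n) α * sharpTauberianConstant (strongBasis n) β := by
  refine sharpTauberianConstant_le fun E hE _ _ => ?_
  calc volume (haloSet (strongBasis n) (α * β) E)
      ≤ volume (haloSet (strongBasis n) α (haloSet (strongBasis n) β E)) :=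
        measure_mono (haloSet_mul_subset hα hβ hE)
    _ ≤ sharpTauberianConstant (strongBasis n) α * volume (haloSet (strongBasis n) β E) :=
        volume_haloSet_le hα.2 (isOpen_haloSet_strongBasis β hE).measurableSet
    _ ≤ sharpTauberianConstant (strongBasis n) α *
          (sharpTauberianConstant (strongBasis n) β * volume E) := by
        gcongr
        exact volume_haloSet_le hβ.2 hE
    _ = _ := (mul_assoc _ _ _).symm

theorem sharpTauberianConstant_pow_succ_le {α : ℝ} (hα : α ∈ Ico (0 : ℝ) 1) (k : ℕ) :
    sharpTauberianConstant (strongBasis n) (α ^ (k + 1)) ≤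
      sharpTauberianConstant (strongBasis n) α ^ (k + 1) := by
  induction k with
  | zero => simp
  | succ k ih =>
    have hpow : α ^ (k + 1) ∈ Ico (0 : ℝ) 1 :=
      ⟨pow_nonneg hα.1 _, pow_lt_one₀ hα.1 hα.2 k.succ_ne_zero⟩
    rw [pow_succ α, pow_succ (sharpTauberianConstant _ _)]
    exact (sharpTauberianConstant_mul_le hpow hα).trans (by gcongr)

end TauberianConstant

section DefectHalo

variable {X Y : Type*} [MeasurableSpace X] [MeasurableSpace Y]

/-- The union of the members of the family `𝓡` of which less than the proportion `η` lies outside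
`U`. Measuring the defect `1 - α` instead of the density `α` keeps the arithmetic of products of
families inside `ℝ≥0∞`. -/
def defectHalo (μ : Measure X) (𝓡 : Set (Set X)) (η : ℝ≥0∞) (U : Set X) : Set X :=
  ⋃₀ {R ∈ 𝓡 | μ (R \ U) < η * μ R}

theorem mem_defectHalo {μ : Measure X} {𝓡 : Set (Set X)} {η : ℝ≥0∞} {U : Set X} {x : X} :
    x ∈ defectHalo μ 𝓡 η U ↔ ∃ R ∈ 𝓡, μ (R \ U) < η * μ R ∧ x ∈ R := by
  simp only [defectHalo, mem_sUnion, mem_ofPred_eq, and_assoc]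

theorem defectHalo_mono (μ : Measure X) (𝓡 : Set (Set X)) (η : ℝ≥0∞) :
    Monotone (defectHalo μ 𝓡 η) := fun _ _ hUV => sUnion_subset_sUnion fun _ hR =>
  ⟨hR.1, (measure_mono (sdiff_subset_sdiff_right hUV)).trans_lt hR.2⟩

theorem isOpen_defectHalo [TopologicalSpace X] (μ : Measure X) {𝓡 : Set (Set X)}
    (h𝓡 : ∀ R ∈ 𝓡, IsOpen R) (η : ℝ≥0∞) (U : Set X) : IsOpen (defectHalo μ 𝓡 η U) :=
  isOpen_sUnion fun R hR => h𝓡 R hR.1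

/-- The halo `defectHalo μ 𝓡 η U` of every open set `U` has measure at most `c⁻¹ * μ U`. -/
def HasHaloBound [TopologicalSpace X] (μ : Measure X) (𝓡 : Set (Set X)) (η c : ℝ≥0∞) : Prop :=
  ∀ U, IsOpen U → c * μ (defectHalo μ 𝓡 η U) ≤ μ U

theorem HasHaloBound.mul_measure_le [TopologicalSpace X] {μ : Measure X} [μ.OuterRegular]
    {𝓡 : Set (Set X)} {η c : ℝ≥0∞} (h : HasHaloBound μ 𝓡 η c) (E : Set X) :
    c * μ (defectHalo μ 𝓡 η E) ≤ μ E := by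
  rw [E.measure_eq_iInf_isOpen μ]
  refine le_iInf₂ fun U hEU => le_iInf fun hU => le_trans ?_ (h U hU)
  gcongr
  exact defectHalo_mono μ 𝓡 η hEU

theorem HasHaloBound.of_homeomorph [TopologicalSpace X] [TopologicalSpace Y] [BorelSpace X]
    [BorelSpace Y] {μ : Measure X} {ν : Measure Y} {𝓡 : Set (Set Y)} {𝓢 : Set (Set X)}
    {η c : ℝ≥0∞} (h : HasHaloBound ν 𝓡 η c) (e : X ≃ₜ Y) (he : MeasurePreserving e μ ν)
    (h𝓢 : 𝓢 ⊆ preimage e '' 𝓡) : HasHaloBound μ 𝓢 η c := by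
  intro U hU
  have hmeas (V : Set Y) : μ (e ⁻¹' V) = ν V := he.measure_preimage_emb e.measurableEmbedding V
  have hUV : e ⁻¹' (e.symm ⁻¹' U) = U := by
    rw [← preimage_comp, e.symm_comp_self, preimage_id]
  have hsub : defectHalo μ 𝓢 η U ⊆ e ⁻¹' defectHalo ν 𝓡 η (e.symm ⁻¹' U) := by
    rintro x ⟨_, ⟨hS, hdefect⟩, hx⟩
    obtain ⟨R, hR, rfl⟩ := h𝓢 hS
    refine ⟨R, ⟨hR, ?_⟩, hx⟩
    rwa [← hmeas R, ← hmeas (R \ _), preimage_sdiff, hUV]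
  calc c * μ (defectHalo μ 𝓢 η U)
      ≤ c * ν (defectHalo ν 𝓡 η (e.symm ⁻¹' U)) := by
        rw [← hmeas]
        gcongr
    _ ≤ ν (e.symm ⁻¹' U) := h _ (hU.preimage e.symm.continuous)
    _ = μ U := by rw [← hmeas, hUV]

end DefectHalo

section Intervals

/-- The family of all open intervals `Ioo a b`. -/
def openIntervals (X : Type*) [Preorder X] : Set (Set X) :=
  range fun p : X × X => Ioo p.1 p.2

theorem isOpen_of_mem_openIntervals {X : Type*} [LinearOrder X] [TopologicalSpace X]
    [OrderClosedTopology X] {I : Set X} (hI : I ∈ openIntervals X) : IsOpen I := by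
  obtain ⟨p, rfl⟩ := hI
  exact isOpen_Ioo

theorem sum_measure_le_mul_measure_biUnion {X ι : Type*} [MeasurableSpace X] (μ : Measure X)
    {s : Finset ι} {A : ι → Set X} [∀ x, DecidablePred (x ∈ A ·)]
    (hA : ∀ i ∈ s, MeasurableSet (A i)) {k : ℕ} (hk : ∀ x, {i ∈ s | x ∈ A i}.card ≤ k) :
    ∑ i ∈ s, μ (A i) ≤ k * μ (⋃ i ∈ s, A i) := by
  calc ∑ i ∈ s, μ (A i) = ∑ i ∈ s, ∫⁻ x, (A i).indicator 1 x ∂μ :=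
        Finset.sum_congr rfl fun i hi => (lintegral_indicator_one (hA i hi)).symm
    _ = ∫⁻ x, ∑ i ∈ s, (A i).indicator 1 x ∂μ :=
        (lintegral_finsetSum' _ fun i hi =>
          (measurable_one.indicator (hA i hi)).aemeasurable).symm
    _ ≤ ∫⁻ x, (⋃ i ∈ s, A i).indicator (fun _ => (k : ℝ≥0∞)) x ∂μ := by
        refine lintegral_mono fun x => ?_
        by_cases hx : x ∈ ⋃ i ∈ s, A i
        · simp only [indicator_of_mem hx, indicator_apply, Pi.one_apply, Finset.sum_boole]
          exact_mod_cast hk x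
        · refine (Finset.sum_eq_zero fun i hi => ?_).trans_le zero_le
          exact indicator_of_notMem (fun hxi => hx (mem_biUnion (Finset.mem_coe.2 hi) hxi)) _
    _ = k * μ (⋃ i ∈ s, A i) := lintegral_indicator_const (s.measurableSet_biUnion hA) _

/-- Three open intervals with a common point cannot all belong to a subfamily of minimal
cardinality with the same union: the one reaching furthest to the left and the one reaching
furthest to the right cover the third. -/
theorem exists_subfamily_card_le_two {X : Type*} [LinearOrder X] (t : Finset (X × X)) :
    ∃ s ⊆ t, (⋃ p ∈ s, Ioo p.1 p.2) = (⋃ p ∈ t, Ioo p.1 p.2) ∧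
      ∀ x, {p ∈ s | x ∈ Ioo p.1 p.2}.card ≤ 2 := by
  classical
  obtain ⟨s, hs, hmin⟩ := Finset.exists_min_image
    {s ∈ t.powerset | (⋃ p ∈ s, Ioo p.1 p.2) = ⋃ p ∈ t, Ioo p.1 p.2} Finset.card ⟨t, by simp⟩
  simp only [Finset.mem_filter, Finset.mem_powerset] at hs hmin
  refine ⟨s, hs.1, hs.2, fun x => ?_⟩
  by_contra! hcard
  set F := {p ∈ s | x ∈ Ioo p.1 p.2}
  have hF {p : X × X} : p ∈ F ↔ p ∈ s ∧ x ∈ Ioo p.1 p.2 := Finset.mem_filter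
  have hne : F.Nonempty := Finset.card_pos.1 (by omega)
  obtain ⟨l, hl, hleft⟩ := Finset.exists_min_image F Prod.fst hne
  obtain ⟨r, hr, hright⟩ := Finset.exists_max_image F Prod.snd hne
  obtain ⟨u, hu, hulr⟩ := Finset.exists_mem_notMem_of_card_lt_card
    (s := {l, r}) (t := F) (Finset.card_le_two.trans_lt hcard)
  simp only [Finset.mem_insert, Finset.mem_singleton, not_or] at hulr
  have hl_erase : l ∈ s.erase u := Finset.mem_erase.2 ⟨Ne.symm hulr.1, (hF.1 hl).1⟩
  have hr_erase : r ∈ s.erase u := Finset.mem_erase.2 ⟨Ne.symm hulr.2, (hF.1 hr).1⟩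
  have hcover : Ioo u.1 u.2 ⊆ ⋃ p ∈ s.erase u, Ioo p.1 p.2 := by
    intro y hy
    rcases lt_or_ge y l.2 with hyl | hly
    · exact mem_biUnion hl_erase ⟨(hleft u hu).trans_lt hy.1, hyl⟩
    · exact mem_biUnion hr_erase ⟨(hF.1 hr).2.1.trans ((hF.1 hl).2.2.trans_le hly),
        hy.2.trans_le (hright u hu)⟩
  have hunion : (⋃ p ∈ s.erase u, Ioo p.1 p.2) = ⋃ p ∈ t, Ioo p.1 p.2 := by
    rw [← hs.2]
    conv_rhs => rw [← Finset.insert_erase (hF.1 hu).1]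
    rw [Finset.set_biUnion_insert, union_eq_right.2 hcover]
  exact (Finset.card_erase_lt_of_mem (hF.1 hu).1).not_ge
    (hmin _ ⟨(Finset.erase_subset _ _).trans hs.1, hunion⟩)

variable {X : Type*} [LinearOrder X] [TopologicalSpace X] [OrderTopology X] [CompactIccSpace X]
  [MeasurableSpace X] [OpensMeasurableSpace X]

theorem mul_measure_biUnion_Ioo_le {μ : Measure X} [IsFiniteMeasureOnCompacts μ] {η : ℝ≥0∞}
    {U : Set X} (t : Finset (X × X))
    (ht : ∀ p ∈ t, μ (Ioo p.1 p.2 \ U) ≤ η * μ (Ioo p.1 p.2)) :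
    (1 - 2 * η) * μ (⋃ p ∈ t, Ioo p.1 p.2) ≤ μ U := by
  obtain ⟨s, hst, hunion, hcard⟩ := exists_subfamily_card_le_two t
  rw [← hunion]
  set W := ⋃ p ∈ s, Ioo p.1 p.2 with hW
  have hW_top : μ W ≠ ∞ :=
    ((measure_biUnion_finset_le s _).trans_lt (ENNReal.sum_lt_top.2 fun _ _ =>
      (measure_mono Ioo_subset_Icc_self).trans_lt isCompact_Icc.measure_lt_top)).ne
  have hdefect : μ (W \ U) ≤ 2 * η * μ W :=
    calc μ (W \ U) ≤ ∑ p ∈ s, μ (Ioo p.1 p.2 \ U) := by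
          simp only [hW, iUnion_sdiff]
          exact measure_biUnion_finset_le s _
      _ ≤ ∑ p ∈ s, η * μ (Ioo p.1 p.2) := Finset.sum_le_sum fun p hp => ht p (hst hp)
      _ = η * ∑ p ∈ s, μ (Ioo p.1 p.2) := (Finset.mul_sum _ _ _).symm
      _ ≤ η * (2 * μ W) := by
          gcongr
          exact_mod_cast sum_measure_le_mul_measure_biUnion μ (fun _ _ => measurableSet_Ioo) hcard
      _ = 2 * η * μ W := by ring
  rw [ENNReal.sub_mul fun _ _ => hW_top, one_mul, tsub_le_iff_right]
  calc μ W ≤ μ (U ∪ W \ U) := measure_mono (by rw [union_sdiff_self]; exact subset_union_right)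
    _ ≤ μ U + μ (W \ U) := measure_union_le _ _
    _ ≤ μ U + 2 * η * μ W := by gcongr

theorem hasHaloBound_openIntervals (μ : Measure X) [μ.Regular] (η : ℝ≥0∞) :
    HasHaloBound μ (openIntervals X) η (1 - 2 * η) := by
  intro U _
  have hopen := isOpen_defectHalo μ (fun _ => isOpen_of_mem_openIntervals) η U
  rw [hopen.measure_eq_iSup_isCompact, ENNReal.mul_iSup]
  refine iSup_le fun K => ?_
  rw [ENNReal.mul_iSup]
  refine iSup_le fun hK => ?_
  rw [ENNReal.mul_iSup]
  refine iSup_le fun hK_compact => ?_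
  obtain ⟨T, hT, hT_fin, hKT⟩ := hK_compact.elim_finite_subcover_image
    (b := {p : X × X | μ (Ioo p.1 p.2 \ U) < η * μ (Ioo p.1 p.2)}) (c := fun p => Ioo p.1 p.2)
    (fun _ _ => isOpen_Ioo) fun x hx => by
      obtain ⟨_, ⟨⟨p, rfl⟩, hp⟩, hxp⟩ := hK hx
      exact mem_biUnion hp hxp
  lift T to Finset (X × X) using hT_fin
  calc (1 - 2 * η) * μ K ≤ (1 - 2 * η) * μ (⋃ p ∈ T, Ioo p.1 p.2) := by
        gcongr
        exact hKT
    _ ≤ μ U := mul_measure_biUnion_Ioo_le T fun p hp => (hT hp).le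

end Intervals

section Product

theorem measure_setOf_le_measure_slice_lt {X Y : Type*} [MeasurableSpace X] [MeasurableSpace Y]
    {μ : Measure X} {ν : Measure Y} [SFinite μ] [SFinite ν]
    {V : Set (X × Y)} (hV : MeasurableSet V) {a b : ℝ≥0∞} (h : μ.prod ν V < a * b) :
    ν {y | a ≤ μ ((·, y) ⁻¹' V)} < b := by
  refine lt_of_mul_lt_mul_left' (a := a) (lt_of_le_of_lt ?_ h)
  rw [Measure.prod_apply_symm hV]
  exact mul_meas_ge_le_lintegral (measurable_measure_prodMk_right hV) a

variable {X Y : Type*} [TopologicalSpace X] [TopologicalSpace Y]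

theorem isOpen_setOf_measure_sdiff_slice_lt [MeasurableSpace Y] [T2Space Y]
    [OpensMeasurableSpace Y] (ν : Measure Y) [ν.InnerRegularCompactLTTop] {W : Set (X × Y)}
    (hW : IsOpen W) {J : Set Y} (hJ : MeasurableSet J) (hJ_top : ν J ≠ ∞) (c : ℝ≥0∞) :
    IsOpen {x | ν (J \ Prod.mk x ⁻¹' W) < c} := by
  refine isOpen_iff_mem_nhds.2 fun x hx => ?_
  have hslice : MeasurableSet (J ∩ Prod.mk x ⁻¹' W) :=
    hJ.inter (hW.preimage (Continuous.prodMk_right x)).measurableSet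
  obtain ⟨K, hKsub, hK, hlt⟩ := hslice.exists_isCompact_sdiff_lt
    (measure_ne_top_of_subset inter_subset_left hJ_top) (tsub_pos_iff_lt.2 hx).ne'
  obtain ⟨u, v, hu, -, hxu, hKv, huv⟩ := generalized_tube_lemma (isCompact_singleton (x := x)) hK
    hW (by
      rintro ⟨_, y⟩ ⟨rfl, hy⟩
      exact (hKsub hy).2)
  refine mem_of_superset (hu.mem_nhds (hxu rfl)) fun x' hx' => ?_
  have hsub : J \ Prod.mk x' ⁻¹' W ⊆ J \ Prod.mk x ⁻¹' W ∪ (J ∩ Prod.mk x ⁻¹' W) \ K := by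
    rintro y ⟨hyJ, hyW⟩
    have hyK : y ∉ K := fun hy => hyW (huv ⟨hx', hKv hy⟩)
    by_cases hyx : y ∈ Prod.mk x ⁻¹' W
    · exact .inr ⟨⟨hyJ, hyx⟩, hyK⟩
    · exact .inl ⟨hyJ, hyx⟩
  calc ν (J \ Prod.mk x' ⁻¹' W)
      ≤ ν (J \ Prod.mk x ⁻¹' W) + ν ((J ∩ Prod.mk x ⁻¹' W) \ K) :=
        (measure_mono hsub).trans (measure_union_le _ _)
    _ < ν (J \ Prod.mk x ⁻¹' W) + (c - ν (J \ Prod.mk x ⁻¹' W)) :=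
        ENNReal.add_lt_add_left (measure_ne_top_of_subset sdiff_subset hJ_top) hlt
    _ = c := add_tsub_cancel_of_le (le_of_lt hx)

/-- The halo formed separately in each slice of `W` with fixed first coordinate. -/
def sliceHalo {X Y : Type*} [MeasurableSpace Y] (ν : Measure Y) (𝓙 : Set (Set Y)) (η : ℝ≥0∞)
    (W : Set (X × Y)) : Set (X × Y) :=
  {z | z.2 ∈ defectHalo ν 𝓙 η (Prod.mk z.1 ⁻¹' W)}

theorem isOpen_sliceHalo [MeasurableSpace Y] [T2Space Y] [OpensMeasurableSpace Y] (ν : Measure Y)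
    [ν.InnerRegularCompactLTTop] {𝓙 : Set (Set Y)}
    (h𝓙 : ∀ J ∈ 𝓙, IsOpen J) (h𝓙_top : ∀ J ∈ 𝓙, ν J ≠ ∞) (η : ℝ≥0∞) {W : Set (X × Y)}
    (hW : IsOpen W) : IsOpen (sliceHalo ν 𝓙 η W) := by
  have hunion : sliceHalo ν 𝓙 η W =
      ⋃ J ∈ 𝓙, {x | ν (J \ Prod.mk x ⁻¹' W) < η * ν J} ×ˢ J := by
    ext z
    simp only [sliceHalo, mem_ofPred_eq, mem_defectHalo, mem_iUnion, mem_prod, exists_prop]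
  rw [hunion]
  exact isOpen_biUnion fun J hJ =>
    (isOpen_setOf_measure_sdiff_slice_lt ν hW (h𝓙 J hJ).measurableSet (h𝓙_top J hJ) _).prod
      (h𝓙 J hJ)

variable [MeasurableSpace X] [MeasurableSpace Y] [BorelSpace X] [BorelSpace Y]
  [SecondCountableTopology Y]

theorem HasHaloBound.mul_measure_sliceHalo_le {μ : Measure X} {ν : Measure Y} [T2Space Y]
    [SFinite ν] [ν.InnerRegularCompactLTTop] {𝓙 : Set (Set Y)} {η c : ℝ≥0∞}
    (h : HasHaloBound ν 𝓙 η c) (h𝓙 : ∀ J ∈ 𝓙, IsOpen J)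
    (h𝓙_top : ∀ J ∈ 𝓙, ν J ≠ ∞) {W : Set (X × Y)} (hW : IsOpen W) :
    c * μ.prod ν (sliceHalo ν 𝓙 η W) ≤ μ.prod ν W := by
  have hhalo := (isOpen_sliceHalo ν h𝓙 h𝓙_top η hW).measurableSet
  rw [Measure.prod_apply hhalo, Measure.prod_apply hW.measurableSet,
    ← lintegral_const_mul _ (measurable_measure_prodMk_left hhalo)]
  exact lintegral_mono fun x => h _ (hW.preimage (Continuous.prodMk_right x))

/-- A rectangle `I ×ˢ J` of defect less than `η * δ` has slices `I × {y}` of defect less than `η`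
for all `y ∈ J` outside a set of proportion less than `δ`. -/
theorem defectHalo_prod_subset {μ : Measure X} {ν : Measure Y} [SFinite μ] [SFinite ν]
    {𝓘 : Set (Set X)} {𝓙 : Set (Set Y)} (h𝓘 : ∀ I ∈ 𝓘, IsOpen I) (h𝓙 : ∀ J ∈ 𝓙, IsOpen J)
    (η δ : ℝ≥0∞) {U : Set (X × Y)} (hU : IsOpen U) :
    defectHalo (μ.prod ν) (image2 (· ×ˢ ·) 𝓘 𝓙) (η * δ) U ⊆
      sliceHalo ν 𝓙 δ (Prod.swap ⁻¹' sliceHalo μ 𝓘 η (Prod.swap ⁻¹' U)) := by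
  rintro ⟨x, y⟩ ⟨_, ⟨⟨I, hI, J, hJ, rfl⟩, hdefect⟩, hx, hy⟩
  have hV := ((h𝓘 I hI).prod (h𝓙 J hJ)).measurableSet.diff hU.measurableSet
  rw [Measure.prod_prod, mul_mul_mul_comm] at hdefect
  refine ⟨J, ⟨hJ, (measure_mono ?_).trans_lt (measure_setOf_le_measure_slice_lt hV hdefect)⟩,
    hy⟩
  rintro y' ⟨hy', hhalo⟩
  rw [mem_ofPred_eq, ← not_lt]
  refine fun hlt => hhalo ⟨I, ⟨hI, ?_⟩, hx⟩
  convert hlt using 2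
  ext x'
  simp [hy']

theorem HasHaloBound.prod [SecondCountableTopology X] [T2Space X] [T2Space Y] {μ : Measure X}
    {ν : Measure Y} [SFinite μ] [SFinite ν] [μ.InnerRegularCompactLTTop]
    [ν.InnerRegularCompactLTTop] {𝓘 : Set (Set X)} {𝓙 : Set (Set Y)} {η δ c d : ℝ≥0∞}
    (hμ : HasHaloBound μ 𝓘 η c) (hν : HasHaloBound ν 𝓙 δ d)
    (h𝓘 : ∀ I ∈ 𝓘, IsOpen I) (h𝓘_top : ∀ I ∈ 𝓘, μ I ≠ ∞)
    (h𝓙 : ∀ J ∈ 𝓙, IsOpen J) (h𝓙_top : ∀ J ∈ 𝓙, ν J ≠ ∞) :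
    HasHaloBound (μ.prod ν) (image2 (· ×ˢ ·) 𝓘 𝓙) (η * δ) (c * d) := by
  intro U hU
  have hU' : IsOpen (Prod.swap ⁻¹' U) := hU.preimage continuous_swap
  set W := sliceHalo μ 𝓘 η (Prod.swap ⁻¹' U)
  have hW : IsOpen W := isOpen_sliceHalo μ h𝓘 h𝓘_top η hU'
  have hswap {V : Set (X × Y)} (hV : IsOpen V) : ν.prod μ (Prod.swap ⁻¹' V) = μ.prod ν V :=
    Measure.measurePreserving_swap.measure_preimage hV.measurableSet.nullMeasurableSet
  calc c * d * μ.prod ν (defectHalo (μ.prod ν) (image2 (· ×ˢ ·) 𝓘 𝓙) (η * δ) U)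
      ≤ c * (d * μ.prod ν (sliceHalo ν 𝓙 δ (Prod.swap ⁻¹' W))) := by
        rw [mul_assoc]
        gcongr
        exact defectHalo_prod_subset h𝓘 h𝓙 η δ hU
    _ ≤ c * μ.prod ν (Prod.swap ⁻¹' W) := by
        gcongr
        exact hν.mul_measure_sliceHalo_le h𝓙 h𝓙_top (hW.preimage continuous_swap)
    _ = c * ν.prod μ W := by rw [← hswap (hW.preimage continuous_swap)]; rfl
    _ ≤ ν.prod μ (Prod.swap ⁻¹' U) := hμ.mul_measure_sliceHalo_le h𝓘 h𝓘_top hU'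
    _ = μ.prod ν U := hswap hU

end Product

section Solyanik

variable {n : ℕ}

theorem strongBasis_succ_subset_preimage :
    strongBasis (n + 1) ⊆ preimage (Fin.consEquivL ℝ fun _ => ℝ).toHomeomorph.symm ''
      image2 (· ×ˢ ·) (openIntervals ℝ) (strongBasis n) := by
  rintro _ ⟨a, b, hab, rfl⟩
  refine ⟨_, ⟨_, ⟨(a 0, b 0), rfl⟩, _, ⟨Fin.tail a, Fin.tail b, fun i => hab i.succ, rfl⟩, rfl⟩,
    ?_⟩
  ext x
  simp [Fin.forall_fin_succ, Fin.tail]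

theorem hasHaloBound_strongBasis (n : ℕ) (η : ℝ≥0∞) :
    HasHaloBound volume (strongBasis n) (η ^ n) ((1 - 2 * η) ^ n) := by
  induction n with
  | zero =>
    intro U _
    rw [pow_zero, pow_zero, one_mul]
    refine measure_mono fun x hx => ?_
    obtain ⟨R, -, hdefect, -⟩ := mem_defectHalo.1 hx
    by_contra hxU
    refine hdefect.not_ge ((one_mul _).trans_le (measure_mono fun y hy => ⟨hy, ?_⟩))
    rwa [Subsingleton.elim y x]
  | succ n ih =>
    rw [pow_succ', pow_succ']
    refine (HasHaloBound.prod (hasHaloBound_openIntervals (volume : Measure ℝ) η) ih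
      (fun _ => isOpen_of_mem_openIntervals) ?_ (fun _ => isOpen_of_mem_strongBasis)
      fun _ => volume_ne_top_of_mem_strongBasis).of_homeomorph _
      (volume_preserving_piFinSuccAbove (fun _ => ℝ) 0) strongBasis_succ_subset_preimage
    rintro _ ⟨p, rfl⟩
    exact measure_Ioo_lt_top.ne

theorem measure_sdiff_lt_mul_of_mul_lt_measure_inter {X : Type*} [MeasurableSpace X]
    {μ : Measure X} {E R : Set X} (hE : MeasurableSet E) (hR : μ R ≠ ∞) {η : ℝ≥0∞}
    (h : (1 - η) * μ R < μ (E ∩ R)) : μ (R \ E) < η * μ R := by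
  by_contra! hle
  refine (measure_inter_add_sdiff (μ := μ) R hE).not_gt ?_
  calc μ R ≤ (1 - η) * μ R + η * μ R := by
        rw [← add_mul]
        exact le_mul_of_one_le_left' le_tsub_add
    _ < μ (R ∩ E) + μ (R \ E) := by
        rw [inter_comm]
        exact ENNReal.add_lt_add_of_lt_of_le
          (ne_top_of_le_ne_top (measure_ne_top_of_subset sdiff_subset hR) hle) h hle

theorem haloSet_subset_defectHalo {η : ℝ} (hη : 0 ≤ η) {E : Set (Fin n → ℝ)}
    (hE : MeasurableSet E) :
    haloSet (strongBasis n) (1 - η) E ⊆ defectHalo volume (strongBasis n) (ENNReal.ofReal η) E := by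
  rw [haloSet_strongBasis_eq_sUnion _ hE, ENNReal.ofReal_sub 1 hη, ENNReal.ofReal_one]
  exact sUnion_subset_sUnion fun R hR => ⟨hR.1,
    measure_sdiff_lt_mul_of_mul_lt_measure_inter hE (volume_ne_top_of_mem_strongBasis hR.1) hR.2⟩

theorem mul_sharpTauberianConstant_one_sub_pow_le_one {η : ℝ} (hη : 0 ≤ η) :
    (1 - 2 * ENNReal.ofReal η) ^ n * sharpTauberianConstant (strongBasis n) (1 - η ^ n) ≤ 1 := by
  simp only [sharpTauberianConstant, ENNReal.mul_iSup]
  refine iSup₂_le fun E hE => iSup₂_le fun hE_pos hE_top => ?_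
  rw [← mul_div_assoc]
  refine ENNReal.div_le_of_le_mul ?_
  calc (1 - 2 * ENNReal.ofReal η) ^ n * volume (haloSet (strongBasis n) (1 - η ^ n) E)
      ≤ (1 - 2 * ENNReal.ofReal η) ^ n *
          volume (defectHalo volume (strongBasis n) (ENNReal.ofReal η ^ n) E) := by
        gcongr
        rw [← ENNReal.ofReal_pow hη]
        exact haloSet_subset_defectHalo (pow_nonneg hη n) hE
    _ ≤ 1 * volume E := by
        rw [one_mul]
        exact (hasHaloBound_strongBasis n _).mul_measure_le E

end Solyanik

section Holder

theorem holderOnWith_of_antitoneOn_of_sub_le {f : ℝ → ℝ} {K : Set ℝ} (hf : AntitoneOn f K)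
    {A : ℝ} {p : ℝ≥0} (hA : 0 ≤ A)
    (h : ∀ x ∈ K, ∀ y ∈ K, x < y → f x - f y ≤ A * (y - x) ^ (p : ℝ)) :
    HolderOnWith A.toNNReal p f K := by
  intro x hx y hy
  wlog hxy : x ≤ y generalizing x y
  · rw [edist_comm, edist_comm x y]
    exact this y hy x hx (le_of_not_ge hxy)
  rcases hxy.eq_or_lt with rfl | hlt
  · simp
  rw [edist_dist, edist_dist, dist_comm x y, Real.dist_eq, Real.dist_eq,
    abs_of_nonneg (sub_nonneg.2 (hf hx hy hxy)), abs_of_nonneg (sub_nonneg.2 hxy),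
    ENNReal.ofReal_rpow_of_nonneg (sub_nonneg.2 hxy) NNReal.zero_le_coe, ← ENNReal.ofReal.eq_1,
    ← ENNReal.ofReal_mul hA]
  exact ENNReal.ofReal_le_ofReal (h x hx y hy hlt)

variable {n : ℕ}

theorem sharpTauberianConstant_lt_top {α : ℝ} (hα : 0 < α) :
    sharpTauberianConstant (strongBasis n) α < ∞ := by
  have hr : 1 - (1 / 4 : ℝ) ^ n ∈ Ico (0 : ℝ) 1 :=
    ⟨sub_nonneg.2 (pow_le_one₀ (by norm_num) (by norm_num)), sub_lt_self 1 (by positivity)⟩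
  have hfactor : (1 - 2 * ENNReal.ofReal (1 / 4)) ^ n ≠ 0 := by
    refine pow_ne_zero n (tsub_pos_iff_lt.2 ?_).ne'
    rw [← ENNReal.ofReal_ofNat, ← ENNReal.ofReal_mul (by norm_num), ENNReal.ofReal_lt_one]
    norm_num
  have hC : sharpTauberianConstant (strongBasis n) (1 - (1 / 4) ^ n) < ∞ :=
    ENNReal.lt_top_of_mul_ne_top_right (ne_top_of_le_ne_top ENNReal.one_ne_top
      (mul_sharpTauberianConstant_one_sub_pow_le_one (by norm_num))) hfactor
  obtain ⟨k, hk⟩ := exists_pow_lt_of_lt_one hα hr.2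
  calc sharpTauberianConstant (strongBasis n) α
      ≤ sharpTauberianConstant (strongBasis n) ((1 - (1 / 4) ^ n) ^ (k + 1)) :=
        sharpTauberianConstant_anti _
          ((pow_le_pow_of_le_one hr.1 hr.2.le k.le_succ).trans hk.le)
    _ ≤ sharpTauberianConstant (strongBasis n) (1 - (1 / 4) ^ n) ^ (k + 1) :=
        sharpTauberianConstant_pow_succ_le hr k
    _ < ∞ := ENNReal.pow_lt_top hC

theorem antitoneOn_toReal_sharpTauberianConstant :
    AntitoneOn (fun α => (sharpTauberianConstant (strongBasis n) α).toReal) (Ioi 0) :=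
  fun _ hx _ _ hxy => ENNReal.toReal_mono (sharpTauberianConstant_lt_top hx).ne
    (sharpTauberianConstant_anti _ hxy)

theorem toReal_sharpTauberianConstant_mul_sub_le {η β : ℝ} (hη : η ∈ Ioc (0 : ℝ) 1)
    (hβ : β ∈ Ioo (0 : ℝ) 1) :
    (sharpTauberianConstant (strongBasis n) ((1 - η ^ n) * β)).toReal -
        (sharpTauberianConstant (strongBasis n) β).toReal ≤
      2 * n * η * (sharpTauberianConstant (strongBasis n) ((1 - η ^ n) * β)).toReal := by
  have hα : 1 - η ^ n ∈ Ico (0 : ℝ) 1 :=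
    ⟨sub_nonneg.2 (pow_le_one₀ hη.1.le hη.2), sub_lt_self 1 (pow_pos hη.1 n)⟩
  set c := 1 - 2 * ENNReal.ofReal η
  set f := fun α => (sharpTauberianConstant (strongBasis n) α).toReal
  have hle : c.toReal ^ n * f ((1 - η ^ n) * β) ≤ f β := by
    rw [← ENNReal.toReal_pow, ← ENNReal.toReal_mul]
    refine ENNReal.toReal_mono (sharpTauberianConstant_lt_top hβ.1).ne ?_
    calc c ^ n * sharpTauberianConstant (strongBasis n) ((1 - η ^ n) * β)
        ≤ c ^ n * (sharpTauberianConstant (strongBasis n) (1 - η ^ n) *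
            sharpTauberianConstant (strongBasis n) β) := by
          gcongr
          exact sharpTauberianConstant_mul_le hα ⟨hβ.1.le, hβ.2⟩
      _ ≤ 1 * sharpTauberianConstant (strongBasis n) β := by
          rw [← mul_assoc]
          gcongr
          exact mul_sharpTauberianConstant_one_sub_pow_le_one hη.1.le
      _ = sharpTauberianConstant (strongBasis n) β := one_mul _
  have hc : 1 - 2 * η ≤ c.toReal := by
    simpa [ENNReal.toReal_ofReal hη.1.le] using
      ENNReal.le_toReal_sub (a := 1) (b := 2 * ENNReal.ofReal η) (by finiteness)
  have hbernoulli : 1 - 2 * n * η ≤ c.toReal ^ n :=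
    calc 1 - 2 * n * η ≤ 1 + n * (c.toReal - 1) := by
          linarith [mul_le_mul_of_nonneg_left hc (n.cast_nonneg (α := ℝ))]
      _ ≤ c.toReal ^ n := one_add_mul_sub_le_pow (by linarith [c.toReal_nonneg]) n
  have hf : 0 ≤ f ((1 - η ^ n) * β) := ENNReal.toReal_nonneg
  linarith [mul_le_mul_of_nonneg_right hbernoulli hf]

theorem toReal_sharpTauberianConstant_sub_le (hn : n ≠ 0) {a x y : ℝ} (ha : 0 < a)
    (hax : a ≤ x) (hxy : x < y) (hy : y < 1) :
    (sharpTauberianConstant (strongBasis n) x).toReal -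
        (sharpTauberianConstant (strongBasis n) y).toReal ≤
      2 * n * (sharpTauberianConstant (strongBasis n) a).toReal / a ^ (n : ℝ)⁻¹ *
        (y - x) ^ (n : ℝ)⁻¹ := by
  have hx : 0 < x := ha.trans_le hax
  have hy0 : 0 < y := hx.trans hxy
  have hratio : 1 - x / y ∈ Ioo (0 : ℝ) 1 :=
    ⟨sub_pos.2 ((div_lt_one hy0).2 hxy), sub_lt_self 1 (div_pos hx hy0)⟩
  set η := (1 - x / y) ^ (n : ℝ)⁻¹
  have hη : η ∈ Ioc (0 : ℝ) 1 := ⟨Real.rpow_pos_of_pos hratio.1 _,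
    Real.rpow_le_one hratio.1.le hratio.2.le (by positivity)⟩
  have hx_eq : (1 - η ^ n) * y = x := by
    rw [Real.rpow_inv_natCast_pow hratio.1.le hn]
    field_simp
    ring
  have hη_le : η ≤ (y - x) ^ (n : ℝ)⁻¹ / a ^ (n : ℝ)⁻¹ := by
    rw [← Real.div_rpow (sub_nonneg.2 hxy.le) ha.le]
    refine Real.rpow_le_rpow hratio.1.le ?_ (by positivity)
    rw [one_sub_div hy0.ne']
    exact div_le_div_of_nonneg_left (sub_nonneg.2 hxy.le) ha (hax.trans hxy.le)
  have hmain := toReal_sharpTauberianConstant_mul_sub_le (n := n) hη ⟨hy0, hy⟩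
  rw [hx_eq] at hmain
  calc _ ≤ 2 * n * η * (sharpTauberianConstant (strongBasis n) x).toReal := hmain
    _ ≤ 2 * n * ((y - x) ^ (n : ℝ)⁻¹ / a ^ (n : ℝ)⁻¹) *
          (sharpTauberianConstant (strongBasis n) a).toReal := by
        refine mul_le_mul (by gcongr) ?_ ENNReal.toReal_nonneg (by positivity)
        exact antitoneOn_toReal_sharpTauberianConstant ha hx hax
    _ = _ := by ring

end Holder

theorem mainTheorem5 (n : ℕ) (hn : 1 ≤ n) :
    (∀ α ∈ Set.Ioo (0 : ℝ) 1, sharpTauberianConstant (strongBasis n) α < ∞) ∧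
    IsLocallyHolderOn (1 / (n : ℝ≥0))
      (fun α : ℝ => (sharpTauberianConstant (strongBasis n) α).toReal) (Set.Ioo 0 1) := by
  have hn0 : n ≠ 0 := Nat.one_le_iff_ne_zero.1 hn
  refine ⟨fun α hα => sharpTauberianConstant_lt_top hα.1, fun K hK hK_compact => ?_⟩
  rcases K.eq_empty_or_nonempty with rfl | hK_nonempty
  · exact ⟨0, holderOnWith_empty _ _ _⟩
  obtain ⟨a, haK, ha⟩ := hK_compact.exists_isLeast hK_nonempty
  have ha0 : 0 < a := (hK haK).1
  have hanti : AntitoneOn (fun α => (sharpTauberianConstant (strongBasis n) α).toReal) K :=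
    antitoneOn_toReal_sharpTauberianConstant.mono fun _ hx => (hK hx).1
  refine ⟨_, holderOnWith_of_antitoneOn_of_sub_le hanti
    (A := 2 * n * (sharpTauberianConstant (strongBasis n) a).toReal / a ^ (n : ℝ)⁻¹)
    (by positivity) fun x hx y hy hxy => ?_⟩
  rw [one_div, NNReal.coe_inv, NNReal.coe_natCast]
  exact toReal_sharpTauberianConstant_sub_le hn0 ha0 (ha hx) hxy (hK hy).2
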